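/- Let $k$ be a field of characteristic zero and fix $\lambda\in k$. A weighted infinitesimal bialgebra (of weight $\lambda$) is a $k$-vector space with an associative (not necessarily unital) multiplication and a coassociative (not necessarily counital) comultiplication $\Delta(a)=a_1\otimes a_2$ such that $\Delta(ab)=ab_1\otimes b_2+a_1\otimes a_2b+\lambda\, a\otimes b$. Homomorphisms are linear maps compatible with the multiplications and the comultiplications. Let $E$ be a $k$-vector space, $A\subseteq E$ a subspace with a weighted infinitesimal bialgebra structure $(A,\cdot,\Delta_A)$, and $V$ a complement of $A$ in $E$; identify $A\oplus V$ with $E$ by $(a,x)\mapsto a+x$. Below $a,b\in A$ and $x,y\in V$. **Type (I) data.** These consist of bilinear maps $\triangleright:A\times V\to V$, $\triangleleft:V\times A\to V$, $\theta:A\times A\to V$, $\cdot:V\times V\to V$ and linear maps $\phi:A\to V\otimes A$, $\psi:A\to A\otimes V$, $\rho:V\to A\otimes V$, $\gamma:V\to V\otimes A$, $P:A\to V\otimes V$, $\Delta_V:V\to V\otimes V$, written $\phi(a)=a_{(-1)}\otimes a_{(0)}$, $\psi(a)=a_{(0)}\otimes a_{(1)}$, $\rho(x)=x_{[-1]}\otimes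 x_{[0]}$, $\gamma(x)=x_{[0]}\otimes x_{[1]}$, $P(a)=a_{<1>}\otimes a_{<2>}$, $\Delta_V(x)=x_1\otimes x_2$. The unified product $A^P\#_\theta V$ is $A\oplus V$ with $$(a,x)(b,y)=(ab,\;xy+x\triangleleft b+a\triangleright y+\theta(a,b)),$$ $$\Delta(a)=\Delta_A(a)+\phi(a)+\psi(a)+P(a),\qquad \Delta(x)=\Delta_V(x)+\rho(x)+\gamma(x).$$ $\mathcal{IB}^{(1)}(A,V)$ is the set of those type (I) data for which this multiplication is associative, this comultiplication is coassociative, and 1. $\phi(ab)+\gamma(\theta(a,b))=a_{(-1)}\otimes a_{(0)}b+(a\triangleright b_{(-1)})\otimes b_{(0)}+\theta(a,b_1)\otimes b_2$; 2. $\psi(ab)+\rho(\theta(a,b))=ab_{(0)}\otimes b_{(1)}+a_{(0)}\otimes(a_{(1)}\triangleleft b)+a_1\otimes\theta(a_2,b)$; 3. $\Delta_V(\theta(a,b))+P(ab)=a_{(-1)}\otimes\theta(a_{(0)},b)+a_{<1>}\otimes(a_{<2>}\triangleleft b)+\theta(a,b_{(0)})\otimes b_{(1)}+(a\triangleright b_{<1>})\otimes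 b_{<2>}$; 4. $\rho(xy)=x_{[-1]}\otimes x_{[0]}y$; 5. $\gamma(xy)=xy_{[0]}\otimes y_{[1]}$; 6. $\Delta_V(xy)=x_1\otimes x_2y+xy_1\otimes y_2+x_{[0]}\otimes(x_{[1]}\triangleright y)+(x\triangleleft y_{[-1]})\otimes y_{[0]}+\lambda\,x\otimes y$; 7. $\Delta_V(a\triangleright y)=a_{(-1)}\otimes(a_{(0)}\triangleright y)+(a\triangleright y_1)\otimes y_2+a_{<1>}\otimes a_{<2>}y+\theta(a,y_{[-1]})\otimes y_{[0]}$; 8. $\Delta_V(x\triangleleft b)=x_1\otimes(x_2\triangleleft b)+(x\triangleleft b_{(0)})\otimes b_{(1)}+x_{[0]}\otimes\theta(x_{[1]},b)+xb_{<1>}\otimes b_{<2>}$; 9. $\gamma(x\triangleleft b)=xb_{(-1)}\otimes b_{(0)}+x_{[0]}\otimes x_{[1]}b+(x\triangleleft b_1)\otimes b_2+\lambda\,x\otimes b$; 10. $\rho(a\triangleright y)=a_{(0)}\otimes a_{(1)}y+a_1\otimes(a_2\triangleright y)+ay_{[-1]}\otimes y_{[0]}+\lambda\,a\otimes y$; 11.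 $\rho(x\triangleleft b)=x_{[-1]}\otimes(x_{[0]}\triangleleft b)$; 12. $\gamma(a\triangleright y)=(a\triangleright y_{[0]})\otimes y_{[1]}$. **Type (II) data.** These consist of bilinear maps $\rightharpoonup:V\times A\to A$, $\leftharpoonup:A\times V\to A$, $\triangleright:A\times V\to V$, $\triangleleft:V\times A\to V$, $\sigma:V\times V\to A$, $\cdot:V\times V\to V$ and linear maps $\rho:V\to A\otimes V$, $\gamma:V\to V\otimes A$, $Q:V\to A\otimes A$, $\Delta_V:V\to V\otimes V$, written as above and with $Q(x)=x_{\{1\}}\otimes x_{\{2\}}$. The unified product $A_\sigma\#^QV$ is $A\oplus V$ with $$(a,x)(b,y)=(ab+x\rightharpoonup b+a\leftharpoonup y+\sigma(x,y),\;xy+x\triangleleft b+a\triangleright y),$$ $$\Delta(a)=\Delta_A(a),\qquad \Delta(x)=\Delta_V(x)+\rho(x)+\gamma(x)+Q(x).$$ $\mathcal{IB}^{(2)}(A,V)$ is the set of those type (II) data for which this multiplication is associative, this comultiplication is coassociative, and 1. $\rho(xy)=x_{[-1]}\otimes x_{[0]}y+(x\rightharpoonup y_{[-1]})\otimes y_{[0]}+x_{\{1\}}\otimes(x_{\{2\}}\triangleright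 y)+\sigma(x,y_1)\otimes y_2$; 2. $\gamma(xy)=x_{[0]}\otimes(x_{[1]}\leftharpoonup y)+xy_{[0]}\otimes y_{[1]}+x_1\otimes\sigma(x_2,y)+(x\triangleleft y_{\{1\}})\otimes y_{\{2\}}$; 3. $\Delta_A(x\rightharpoonup b)+Q(x\triangleleft b)=x_{[-1]}\otimes(x_{[0]}\rightharpoonup b)+(x\rightharpoonup b_1)\otimes b_2+x_{\{1\}}\otimes x_{\{2\}}b$; 4. $\Delta_A(a\leftharpoonup y)+Q(a\triangleright y)=a_1\otimes(a_2\leftharpoonup y)+(a\leftharpoonup y_{[0]})\otimes y_{[1]}+ay_{\{1\}}\otimes y_{\{2\}}$; 5. $\Delta_V(a\triangleright y)=(a\triangleright y_1)\otimes y_2$; 6. $\Delta_V(x\triangleleft b)=x_1\otimes(x_2\triangleleft b)$; 7. $\Delta_A(\sigma(x,y))+Q(xy)=x_{[-1]}\otimes\sigma(x_{[0]},y)+x_{\{1\}}\otimes(x_{\{2\}}\leftharpoonup y)+\sigma(x,y_{[0]})\otimes y_{[1]}+(x\rightharpoonup y_{\{1\}})\otimes y_{\{2\}}$; 8. $\gamma(x\triangleleft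 b)=x_1\otimes(x_2\rightharpoonup b)+x_{[0]}\otimes x_{[1]}b+(x\triangleleft b_1)\otimes b_2+\lambda\,x\otimes b$; 9. $\rho(a\triangleright y)=(a\leftharpoonup y_1)\otimes y_2+a_1\otimes(a_2\triangleright y)+ay_{[-1]}\otimes y_{[0]}+\lambda\,a\otimes y$; 10. $\rho(x\triangleleft b)=x_{[-1]}\otimes(x_{[0]}\triangleleft b)$; 11. $\gamma(a\triangleright y)=(a\triangleright y_{[0]})\otimes y_{[1]}$; 12. $\Delta_V(xy)=x_1\otimes x_2y+xy_1\otimes y_2+x_{[0]}\otimes(x_{[1]}\triangleright y)+(x\triangleleft y_{[-1]})\otimes y_{[0]}+\lambda\,x\otimes y$. Two elements $\Omega,\Omega'$ of the disjoint union $\mathcal{IB}^{(1)}(A,V)\sqcup\mathcal{IB}^{(2)}(A,V)$ (of the same type or not) are equivalent, $\Omega\equiv\Omega'$, if there are linear maps $r:V\to A$ and $s:V\to V$ such that $(a,x)\mapsto(a+r(x),s(x))$ is bijective and a homomorphism of algebras and coalgebras from the unified product of $\Omega$ to that of $\Omega'$. Put $\mathcal{HLB}(V,A)=\big(\mathcal{IB}^{(1)}(A,V)\sqcup\mathcal{IB}^{(2)}(A,V)\big)/\equiv$.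 Let $BExtd(E,A)$ be the set of those weighted infinitesimal bialgebra structures of weight $\lambda$ on $E$ for which the inclusion $A\to E$, or the projection $E\to A$ along $V$, is a homomorphism of algebras and coalgebras, modulo isomorphisms $E\to E$ of algebras and coalgebras that restrict to the identity on $A$. **Theorem.** For every element of $\mathcal{IB}^{(1)}(A,V)$ (respectively $\mathcal{IB}^{(2)}(A,V)$) the unified product $A^P\#_\theta V$ (respectively $A_\sigma\#^QV$), regarded as a structure on $E$, is one of the structures that define $BExtd(E,A)$, and the map $$\Upsilon:\mathcal{HLB}(V,A)\to BExtd(E,A),\qquad \overline{\Omega^{(1)}}\mapsto A^P\#_\theta V,\quad \overline{\Omega^{(2)}}\mapsto A_\sigma\#^QV,$$ is well defined and bijective. -/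

import Mathlib

open scoped TensorProduct

namespace WeightedInf

variable {k : Type*} [Field k]

/-- A bilinear multiplication and a linear comultiplication on `M`, without any law. No unit and
no counit are part of the data. -/
@[ext]
structure BialgData (k : Type*) [Field k] (M : Type*) [AddCommGroup M] [Module k M] where
  /-- the multiplication `a ⊗ b ↦ a b` -/
  mul : M →ₗ[k] M →ₗ[k] M
  /-- the comultiplication `a ↦ a₁ ⊗ a₂` -/
  comul : M →ₗ[k] M ⊗[k] M

/-- `(a b) c = a (b c)`. -/
def IsAssociative {M : Type*} [AddCommGroup M] [Module k M] (mul : M →ₗ[k] M →ₗ[k] M) : Prop :=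
  ∀ a b c : M, mul (mul a b) c = mul a (mul b c)

/-- `Δ(a₁) ⊗ a₂ = a₁ ⊗ Δ(a₂)`. -/
def IsCoassociative {M : Type*} [AddCommGroup M] [Module k M] (comul : M →ₗ[k] M ⊗[k] M) : Prop :=
  ∀ a : M, TensorProduct.assoc k M M M (comul.rTensor M (comul a)) = comul.lTensor M (comul a)

/-- A weighted infinitesimal bialgebra of weight `lam` on the vector space `M`: an associative
algebra and a coassociative coalgebra with `Δ(a b) = a b₁ ⊗ b₂ + a₁ ⊗ a₂ b + lam (a ⊗ b)`. -/
structure InfBialgebra (k : Type*) [Field k] (lam : k) (M : Type*) [AddCommGroup M] [Module k M]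
    extends BialgData k M where
  assoc : IsAssociative mul
  coassoc : IsCoassociative comul
  compat : ∀ a b : M, comul (mul a b) =
    (mul a).rTensor M (comul b) + (mul.flip b).lTensor M (comul a) + lam • (a ⊗ₜ[k] b)

/-- A linear map `f` is a homomorphism of algebras and of coalgebras. -/
structure BialgData.IsHom {M N : Type*} [AddCommGroup M] [Module k M] [AddCommGroup N] [Module k N]
    (S : BialgData k M) (T : BialgData k N) (f : M →ₗ[k] N) : Prop where
  map_mul : ∀ a b : M, f (S.mul a b) = T.mul (f a) (f b)
  map_comul : ∀ a : M, T.comul (f a) = TensorProduct.map f f (S.comul a)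

/-- Transport of a multiplication and a comultiplication along a linear isomorphism. -/
def BialgData.transport {M N : Type*} [AddCommGroup M] [Module k M] [AddCommGroup N] [Module k N]
    (S : BialgData k M) (e : M ≃ₗ[k] N) : BialgData k N where
  mul := LinearMap.mk₂ k (fun x y => e (S.mul (e.symm x) (e.symm y)))
    (by intros; simp) (by intros; simp) (by intros; simp) (by intros; simp)
  comul := TensorProduct.map e.toLinearMap e.toLinearMap ∘ₗ S.comul ∘ₗ e.symm.toLinearMap

section Data

variable (k : Type*) [Field k] (A V : Type*)
  [AddCommGroup A] [Module k A] [AddCommGroup V] [Module k V]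

/-- The linear maps that make up a datum of type (I). -/
structure DatumI where
  /-- `a ▷ x` -/
  actL : A →ₗ[k] V →ₗ[k] V
  /-- `x ◁ a` -/
  actR : V →ₗ[k] A →ₗ[k] V
  /-- `θ(a, b)` -/
  theta : A →ₗ[k] A →ₗ[k] V
  /-- `x y` -/
  mulV : V →ₗ[k] V →ₗ[k] V
  /-- `φ(a) = a₍₋₁₎ ⊗ a₍₀₎` -/
  phi : A →ₗ[k] V ⊗[k] A
  /-- `ψ(a) = a₍₀₎ ⊗ a₍₁₎` -/
  psi : A →ₗ[k] A ⊗[k] V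
  /-- `ρ(x) = x[-1] ⊗ x[0]` -/
  rho : V →ₗ[k] A ⊗[k] V
  /-- `γ(x) = x[0] ⊗ x[1]` -/
  gamma : V →ₗ[k] V ⊗[k] A
  /-- `P(a)` -/
  P : A →ₗ[k] V ⊗[k] V
  /-- `Δ_V(x) = x₁ ⊗ x₂` -/
  comulV : V →ₗ[k] V ⊗[k] V

/-- The linear maps that make up a datum of type (II). -/
structure DatumII where
  /-- `x ⇀ a` -/
  harpL : V →ₗ[k] A →ₗ[k] A
  /-- `a ↼ x` -/
  harpR : A →ₗ[k] V →ₗ[k] A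
  /-- `a ▷ x` -/
  actL : A →ₗ[k] V →ₗ[k] V
  /-- `x ◁ a` -/
  actR : V →ₗ[k] A →ₗ[k] V
  /-- `σ(x, y)` -/
  sigma : V →ₗ[k] V →ₗ[k] A
  /-- `x y` -/
  mulV : V →ₗ[k] V →ₗ[k] V
  /-- `ρ(x) = x[-1] ⊗ x[0]` -/
  rho : V →ₗ[k] A ⊗[k] V
  /-- `γ(x) = x[0] ⊗ x[1]` -/
  gamma : V →ₗ[k] V ⊗[k] A
  /-- `Q(x)` -/
  Q : V →ₗ[k] A ⊗[k] A
  /-- `Δ_V(x) = x₁ ⊗ x₂` -/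
  comulV : V →ₗ[k] V ⊗[k] V

end Data

section Products

variable {A V : Type*} [AddCommGroup A] [Module k A] [AddCommGroup V] [Module k V]

/-- The unified product of type (I) on `A ⊕ V`:
`(a, x)(b, y) = (a b, x y + x ◁ b + a ▷ y + θ(a, b))`,
`Δ(a) = Δ_A(a) + φ(a) + ψ(a) + P(a)`, `Δ(x) = Δ_V(x) + ρ(x) + γ(x)`. -/
def DatumI.unified (D : DatumI k A V) (SA : BialgData k A) : BialgData k (A × V) where
  mul := LinearMap.mk₂ k
    (fun p q => (SA.mul p.1 q.1,
      D.mulV p.2 q.2 + D.actR p.2 q.1 + D.actL p.1 q.2 + D.theta p.1 q.1))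
    (by intros; ext <;> simp; abel) (by intros; ext <;> simp)
    (by intros; ext <;> simp; abel) (by intros; ext <;> simp)
  comul := LinearMap.coprod
    (TensorProduct.map (LinearMap.inl k A V) (LinearMap.inl k A V) ∘ₗ SA.comul
      + TensorProduct.map (LinearMap.inr k A V) (LinearMap.inl k A V) ∘ₗ D.phi
      + TensorProduct.map (LinearMap.inl k A V) (LinearMap.inr k A V) ∘ₗ D.psi
      + TensorProduct.map (LinearMap.inr k A V) (LinearMap.inr k A V) ∘ₗ D.P)
    (TensorProduct.map (LinearMap.inr k A V) (LinearMap.inr k A V) ∘ₗ D.comulV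
      + TensorProduct.map (LinearMap.inl k A V) (LinearMap.inr k A V) ∘ₗ D.rho
      + TensorProduct.map (LinearMap.inr k A V) (LinearMap.inl k A V) ∘ₗ D.gamma)

/-- The unified product of type (II) on `A ⊕ V`:
`(a, x)(b, y) = (a b + x ⇀ b + a ↼ y + σ(x, y), x y + x ◁ b + a ▷ y)`,
`Δ(a) = Δ_A(a)`, `Δ(x) = Δ_V(x) + ρ(x) + γ(x) + Q(x)`. -/
def DatumII.unified (D : DatumII k A V) (SA : BialgData k A) : BialgData k (A × V) where
  mul := LinearMap.mk₂ k
    (fun p q =>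
      (SA.mul p.1 q.1 + D.harpL p.2 q.1 + D.harpR p.1 q.2 + D.sigma p.2 q.2,
        D.mulV p.2 q.2 + D.actR p.2 q.1 + D.actL p.1 q.2))
    (by intros; ext <;> simp <;> abel) (by intros; ext <;> simp)
    (by intros; ext <;> simp <;> abel) (by intros; ext <;> simp)
  comul := LinearMap.coprod
    (TensorProduct.map (LinearMap.inl k A V) (LinearMap.inl k A V) ∘ₗ SA.comul)
    (TensorProduct.map (LinearMap.inr k A V) (LinearMap.inr k A V) ∘ₗ D.comulV
      + TensorProduct.map (LinearMap.inl k A V) (LinearMap.inr k A V) ∘ₗ D.rho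
      + TensorProduct.map (LinearMap.inr k A V) (LinearMap.inl k A V) ∘ₗ D.gamma
      + TensorProduct.map (LinearMap.inl k A V) (LinearMap.inl k A V) ∘ₗ D.Q)

/-- The conditions under which a datum of type (I) is a weighted infinitesimal bialgebraic
extending datum: the unified product is an algebra and a coalgebra, and twelve compatibility
conditions hold. The name of each of the twelve says on which pair of arguments
(in `A` or `V`) and in which summand of `(A ⊕ V) ⊗ (A ⊕ V)` it lives. -/
structure DatumI.IsBialgebraic (lam : k) (SA : BialgData k A) (D : DatumI k A V) : Prop where
  assoc : IsAssociative (D.unified SA).mul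
  coassoc : IsCoassociative (D.unified SA).comul
  /-- `φ(ab) + γ(θ(a,b)) = a₍₋₁₎ ⊗ a₍₀₎ b + (a ▷ b₍₋₁₎) ⊗ b₍₀₎ + θ(a,b₁) ⊗ b₂` -/
  aa_VA : ∀ a b : A, D.phi (SA.mul a b) + D.gamma (D.theta a b) =
    (SA.mul.flip b).lTensor V (D.phi a) + (D.actL a).rTensor A (D.phi b)
      + (D.theta a).rTensor A (SA.comul b)
  /-- `ψ(ab) + ρ(θ(a,b)) = a b₍₀₎ ⊗ b₍₁₎ + a₍₀₎ ⊗ (a₍₁₎ ◁ b) + a₁ ⊗ θ(a₂,b)` -/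
  aa_AV : ∀ a b : A, D.psi (SA.mul a b) + D.rho (D.theta a b) =
    (SA.mul a).rTensor V (D.psi b) + (D.actR.flip b).lTensor A (D.psi a)
      + (D.theta.flip b).lTensor A (SA.comul a)
  /-- `Δ_V(θ(a,b)) + P(ab) = a₍₋₁₎ ⊗ θ(a₍₀₎,b) + a<1> ⊗ (a<2> ◁ b) + θ(a,b₍₀₎) ⊗ b₍₁₎
  + (a ▷ b<1>) ⊗ b<2>` -/
  aa_VV : ∀ a b : A, D.comulV (D.theta a b) + D.P (SA.mul a b) =
    (D.theta.flip b).lTensor V (D.phi a) + (D.actR.flip b).lTensor V (D.P a)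
      + (D.theta a).rTensor V (D.psi b) + (D.actL a).rTensor V (D.P b)
  /-- `ρ(xy) = x[-1] ⊗ x[0] y` -/
  xx_AV : ∀ x y : V, D.rho (D.mulV x y) = (D.mulV.flip y).lTensor A (D.rho x)
  /-- `γ(xy) = x y[0] ⊗ y[1]` -/
  xx_VA : ∀ x y : V, D.gamma (D.mulV x y) = (D.mulV x).rTensor A (D.gamma y)
  /-- `Δ_V(xy) = x₁ ⊗ x₂ y + x y₁ ⊗ y₂ + x[0] ⊗ (x[1] ▷ y) + (x ◁ y[-1]) ⊗ y[0] + lam (x ⊗ y)` -/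
  xx_VV : ∀ x y : V, D.comulV (D.mulV x y) =
    (D.mulV.flip y).lTensor V (D.comulV x) + (D.mulV x).rTensor V (D.comulV y)
      + (D.actL.flip y).lTensor V (D.gamma x) + (D.actR x).rTensor V (D.rho y)
      + lam • (x ⊗ₜ[k] y)
  /-- `Δ_V(a ▷ y) = a₍₋₁₎ ⊗ (a₍₀₎ ▷ y) + (a ▷ y₁) ⊗ y₂ + a<1> ⊗ a<2> y + θ(a,y[-1]) ⊗ y[0]` -/
  ax_VV : ∀ (a : A) (y : V), D.comulV (D.actL a y) =
    (D.actL.flip y).lTensor V (D.phi a) + (D.actL a).rTensor V (D.comulV y)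
      + (D.mulV.flip y).lTensor V (D.P a) + (D.theta a).rTensor V (D.rho y)
  /-- `Δ_V(x ◁ b) = x₁ ⊗ (x₂ ◁ b) + (x ◁ b₍₀₎) ⊗ b₍₁₎ + x[0] ⊗ θ(x[1],b) + x b<1> ⊗ b<2>` -/
  xa_VV : ∀ (x : V) (b : A), D.comulV (D.actR x b) =
    (D.actR.flip b).lTensor V (D.comulV x) + (D.actR x).rTensor V (D.psi b)
      + (D.theta.flip b).lTensor V (D.gamma x) + (D.mulV x).rTensor V (D.P b)
  /-- `γ(x ◁ b) = x b₍₋₁₎ ⊗ b₍₀₎ + x[0] ⊗ x[1] b + (x ◁ b₁) ⊗ b₂ + lam (x ⊗ b)` -/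
  xa_VA : ∀ (x : V) (b : A), D.gamma (D.actR x b) =
    (D.mulV x).rTensor A (D.phi b) + (SA.mul.flip b).lTensor V (D.gamma x)
      + (D.actR x).rTensor A (SA.comul b) + lam • (x ⊗ₜ[k] b)
  /-- `ρ(a ▷ y) = a₍₀₎ ⊗ a₍₁₎ y + a₁ ⊗ (a₂ ▷ y) + a y[-1] ⊗ y[0] + lam (a ⊗ y)` -/
  ax_AV : ∀ (a : A) (y : V), D.rho (D.actL a y) =
    (D.mulV.flip y).lTensor A (D.psi a) + (D.actL.flip y).lTensor A (SA.comul a)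
      + (SA.mul a).rTensor V (D.rho y) + lam • (a ⊗ₜ[k] y)
  /-- `ρ(x ◁ b) = x[-1] ⊗ (x[0] ◁ b)` -/
  xa_AV : ∀ (x : V) (b : A), D.rho (D.actR x b) = (D.actR.flip b).lTensor A (D.rho x)
  /-- `γ(a ▷ y) = (a ▷ y[0]) ⊗ y[1]` -/
  ax_VA : ∀ (a : A) (y : V), D.gamma (D.actL a y) = (D.actL a).rTensor A (D.gamma y)

/-- The conditions under which a datum of type (II) is a weighted infinitesimal bialgebraic
extending datum: the unified product is an algebra and a coalgebra, and twelve compatibility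
conditions hold, named as in type (I). -/
structure DatumII.IsBialgebraic (lam : k) (SA : BialgData k A) (D : DatumII k A V) : Prop where
  assoc : IsAssociative (D.unified SA).mul
  coassoc : IsCoassociative (D.unified SA).comul
  /-- `ρ(xy) = x[-1] ⊗ x[0] y + (x ⇀ y[-1]) ⊗ y[0] + x{1} ⊗ (x{2} ▷ y) + σ(x,y₁) ⊗ y₂` -/
  xx_AV : ∀ x y : V, D.rho (D.mulV x y) =
    (D.mulV.flip y).lTensor A (D.rho x) + (D.harpL x).rTensor V (D.rho y)
      + (D.actL.flip y).lTensor A (D.Q x) + (D.sigma x).rTensor V (D.comulV y)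
  /-- `γ(xy) = x[0] ⊗ (x[1] ↼ y) + x y[0] ⊗ y[1] + x₁ ⊗ σ(x₂,y) + (x ◁ y{1}) ⊗ y{2}` -/
  xx_VA : ∀ x y : V, D.gamma (D.mulV x y) =
    (D.harpR.flip y).lTensor V (D.gamma x) + (D.mulV x).rTensor A (D.gamma y)
      + (D.sigma.flip y).lTensor V (D.comulV x) + (D.actR x).rTensor A (D.Q y)
  /-- `Δ_A(x ⇀ b) + Q(x ◁ b) = x[-1] ⊗ (x[0] ⇀ b) + (x ⇀ b₁) ⊗ b₂ + x{1} ⊗ x{2} b` -/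
  xa_AA : ∀ (x : V) (b : A), SA.comul (D.harpL x b) + D.Q (D.actR x b) =
    (D.harpL.flip b).lTensor A (D.rho x) + (D.harpL x).rTensor A (SA.comul b)
      + (SA.mul.flip b).lTensor A (D.Q x)
  /-- `Δ_A(a ↼ y) + Q(a ▷ y) = a₁ ⊗ (a₂ ↼ y) + (a ↼ y[0]) ⊗ y[1] + a y{1} ⊗ y{2}` -/
  ax_AA : ∀ (a : A) (y : V), SA.comul (D.harpR a y) + D.Q (D.actL a y) =
    (D.harpR.flip y).lTensor A (SA.comul a) + (D.harpR a).rTensor A (D.gamma y)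
      + (SA.mul a).rTensor A (D.Q y)
  /-- `Δ_V(a ▷ y) = (a ▷ y₁) ⊗ y₂` -/
  ax_VV : ∀ (a : A) (y : V), D.comulV (D.actL a y) = (D.actL a).rTensor V (D.comulV y)
  /-- `Δ_V(x ◁ b) = x₁ ⊗ (x₂ ◁ b)` -/
  xa_VV : ∀ (x : V) (b : A), D.comulV (D.actR x b) = (D.actR.flip b).lTensor V (D.comulV x)
  /-- `Δ_A(σ(x,y)) + Q(xy) = x[-1] ⊗ σ(x[0],y) + x{1} ⊗ (x{2} ↼ y) + σ(x,y[0]) ⊗ y[1]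
  + (x ⇀ y{1}) ⊗ y{2}` -/
  xx_AA : ∀ x y : V, SA.comul (D.sigma x y) + D.Q (D.mulV x y) =
    (D.sigma.flip y).lTensor A (D.rho x) + (D.harpR.flip y).lTensor A (D.Q x)
      + (D.sigma x).rTensor A (D.gamma y) + (D.harpL x).rTensor A (D.Q y)
  /-- `γ(x ◁ b) = x₁ ⊗ (x₂ ⇀ b) + x[0] ⊗ x[1] b + (x ◁ b₁) ⊗ b₂ + lam (x ⊗ b)` -/
  xa_VA : ∀ (x : V) (b : A), D.gamma (D.actR x b) =
    (D.harpL.flip b).lTensor V (D.comulV x) + (SA.mul.flip b).lTensor V (D.gamma x)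
      + (D.actR x).rTensor A (SA.comul b) + lam • (x ⊗ₜ[k] b)
  /-- `ρ(a ▷ y) = (a ↼ y₁) ⊗ y₂ + a₁ ⊗ (a₂ ▷ y) + a y[-1] ⊗ y[0] + lam (a ⊗ y)` -/
  ax_AV : ∀ (a : A) (y : V), D.rho (D.actL a y) =
    (D.harpR a).rTensor V (D.comulV y) + (D.actL.flip y).lTensor A (SA.comul a)
      + (SA.mul a).rTensor V (D.rho y) + lam • (a ⊗ₜ[k] y)
  /-- `ρ(x ◁ b) = x[-1] ⊗ (x[0] ◁ b)` -/
  xa_AV : ∀ (x : V) (b : A), D.rho (D.actR x b) = (D.actR.flip b).lTensor A (D.rho x)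
  /-- `γ(a ▷ y) = (a ▷ y[0]) ⊗ y[1]` -/
  ax_VA : ∀ (a : A) (y : V), D.gamma (D.actL a y) = (D.actL a).rTensor A (D.gamma y)
  /-- `Δ_V(xy) = x₁ ⊗ x₂ y + x y₁ ⊗ y₂ + x[0] ⊗ (x[1] ▷ y) + (x ◁ y[-1]) ⊗ y[0] + lam (x ⊗ y)` -/
  xx_VV : ∀ x y : V, D.comulV (D.mulV x y) =
    (D.mulV.flip y).lTensor V (D.comulV x) + (D.mulV x).rTensor V (D.comulV y)
      + (D.actL.flip y).lTensor V (D.gamma x) + (D.actR x).rTensor V (D.rho y)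
      + lam • (x ⊗ₜ[k] y)

/-- The set `IB⁽¹⁾(A, V)`. -/
abbrev IBI (lam : k) (SA : BialgData k A) (V : Type*) [AddCommGroup V] [Module k V] :=
  {D : DatumI k A V // D.IsBialgebraic lam SA}

/-- The set `IB⁽²⁾(A, V)`. -/
abbrev IBII (lam : k) (SA : BialgData k A) (V : Type*) [AddCommGroup V] [Module k V] :=
  {D : DatumII k A V // D.IsBialgebraic lam SA}

/-- The unified product attached to an element of the disjoint union `IB⁽¹⁾ ⊔ IB⁽²⁾`. -/
def unified (lam : k) (SA : BialgData k A) :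
    IBI lam SA V ⊕ IBII lam SA V → BialgData k (A × V)
  | Sum.inl D => D.1.unified SA
  | Sum.inr D => D.1.unified SA

/-- The map `(a, x) ↦ (a + r(x), s(x))`. -/
def phiRS (r : V →ₗ[k] A) (s : V →ₗ[k] V) : (A × V) →ₗ[k] (A × V) :=
  LinearMap.prod (LinearMap.fst k A V + r ∘ₗ LinearMap.snd k A V) (s ∘ₗ LinearMap.snd k A V)

/-- Two extending data, each of either type, are equivalent if some `(a, x) ↦ (a + r(x), s(x))`
is an isomorphism between their unified products. -/
def DataEquiv (lam : k) (SA : BialgData k A) (D D' : IBI lam SA V ⊕ IBII lam SA V) : Prop :=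
  ∃ (r : V →ₗ[k] A) (s : V →ₗ[k] V), Function.Bijective (phiRS r s) ∧
    (unified lam SA D).IsHom (unified lam SA D') (phiRS r s)

theorem BialgData.IsHom.comp {M N L : Type*} [AddCommGroup M] [Module k M] [AddCommGroup N]
    [Module k N] [AddCommGroup L] [Module k L] {S : BialgData k M} {T : BialgData k N}
    {U : BialgData k L} {g : N →ₗ[k] L} {f : M →ₗ[k] N} (hg : T.IsHom U g) (hf : S.IsHom T f) :
    S.IsHom U (g ∘ₗ f) where
  map_mul a b := by simp [hf.map_mul, hg.map_mul]
  map_comul a := by simp [hf.map_comul, hg.map_comul, TensorProduct.map_comp]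

theorem BialgData.IsHom.symm {M N : Type*} [AddCommGroup M] [Module k M] [AddCommGroup N]
    [Module k N] {S : BialgData k M} {T : BialgData k N} (e : M ≃ₗ[k] N)
    (he : S.IsHom T e.toLinearMap) : T.IsHom S e.symm.toLinearMap where
  map_mul a b := by
    have h := he.map_mul (e.symm a) (e.symm b)
    apply e.injective
    simpa using h.symm
  map_comul a := by
    have h := he.map_comul (e.symm a)
    simp only [LinearEquiv.coe_coe, LinearEquiv.apply_symm_apply] at h ⊢
    rw [h, ← LinearMap.comp_apply, ← TensorProduct.map_comp]
    simp

theorem BialgData.IsHom.id {M : Type*} [AddCommGroup M] [Module k M] (S : BialgData k M) :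
    S.IsHom S LinearMap.id where
  map_mul a b := rfl
  map_comul a := by simp

theorem phiRS_apply (r : V →ₗ[k] A) (s : V →ₗ[k] V) (p : A × V) :
    phiRS r s p = (p.1 + r p.2, s p.2) := rfl

theorem dataEquiv_equivalence (lam : k) (SA : BialgData k A) :
    Equivalence (DataEquiv (V := V) lam SA) where
  refl D := by
    have h : phiRS (0 : V →ₗ[k] A) (LinearMap.id : V →ₗ[k] V) = LinearMap.id := by
      ext p <;> simp [phiRS_apply]
    exact ⟨0, LinearMap.id, by rw [h]; exact Function.bijective_id,
      by rw [h]; exact BialgData.IsHom.id _⟩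
  symm := by
    rintro D D' ⟨r, s, hb, hh⟩
    let e := LinearEquiv.ofBijective (phiRS r s) hb
    have hinl : ∀ a : A, e.symm (a, 0) = (a, 0) := by
      intro a
      rw [LinearEquiv.symm_apply_eq]
      simp [e, phiRS_apply]
    have h : phiRS (LinearMap.fst k A V ∘ₗ e.symm.toLinearMap ∘ₗ LinearMap.inr k A V)
        (LinearMap.snd k A V ∘ₗ e.symm.toLinearMap ∘ₗ LinearMap.inr k A V)
        = e.symm.toLinearMap := by
      apply LinearMap.prod_ext
      · ext a <;> simp [phiRS_apply, hinl]
      · ext a <;> simp [phiRS_apply]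
    refine ⟨LinearMap.fst k A V ∘ₗ e.symm.toLinearMap ∘ₗ LinearMap.inr k A V,
      LinearMap.snd k A V ∘ₗ e.symm.toLinearMap ∘ₗ LinearMap.inr k A V, ?_, ?_⟩
    · rw [h]; exact e.symm.bijective
    · rw [h]; exact BialgData.IsHom.symm e hh
  trans := by
    rintro D D' D'' ⟨r, s, hb, hh⟩ ⟨r', s', hb', hh'⟩
    have h : phiRS (r + r' ∘ₗ s) (s' ∘ₗ s) = phiRS r' s' ∘ₗ phiRS r s := by
      ext p <;> simp [phiRS_apply]
    refine ⟨r + r' ∘ₗ s, s' ∘ₗ s, ?_, ?_⟩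
    · rw [h]; exact hb'.comp hb
    · rw [h]; exact hh'.comp hh

/-- The equivalence relation `≡` on `IB⁽¹⁾(A, V) ⊔ IB⁽²⁾(A, V)`. -/
def dataSetoid (lam : k) (SA : BialgData k A) (V : Type*) [AddCommGroup V] [Module k V] :
    Setoid (IBI lam SA V ⊕ IBII lam SA V) :=
  ⟨DataEquiv lam SA, dataEquiv_equivalence lam SA⟩

/-- The set `HLB(V, A) = (IB⁽¹⁾(A, V) ⊔ IB⁽²⁾(A, V)) / ≡`. -/
abbrev HLB (lam : k) (SA : BialgData k A) (V : Type*) [AddCommGroup V] [Module k V] :=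
  Quotient (dataSetoid lam SA V)

end Products

section Extending

variable {E : Type*} [AddCommGroup E] [Module k E] {lam : k} {A V : Submodule k E}

/-- The weighted infinitesimal bialgebra structures on `E` that are extending systems of `A`
through the complement `V`: the inclusion `i : A → E`, or the projection `p : E → A` along `V`,
is a homomorphism of algebras and coalgebras. -/
abbrev ExtStructure (SA : InfBialgebra k lam A) (hAV : IsCompl A V) :=
  {S : InfBialgebra k lam E //
    SA.toBialgData.IsHom S.toBialgData A.subtype ∨
    S.toBialgData.IsHom SA.toBialgData (A.projectionOnto V hAV)}

/-- Equivalence of structures on `E`: an isomorphism of algebras and coalgebras that restricts to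
the identity of `A`. -/
def ExtEquiv (SA : InfBialgebra k lam A) (hAV : IsCompl A V) (S T : ExtStructure SA hAV) : Prop :=
  ∃ f : E ≃ₗ[k] E, S.1.toBialgData.IsHom T.1.toBialgData f.toLinearMap ∧ ∀ a ∈ A, f a = a

theorem extEquiv_equivalence (SA : InfBialgebra k lam A) (hAV : IsCompl A V) :
    Equivalence (ExtEquiv SA hAV) where
  refl S := ⟨LinearEquiv.refl k E, BialgData.IsHom.id _, fun _ _ => rfl⟩
  symm := by
    rintro S T ⟨f, hf, hA⟩
    refine ⟨f.symm, BialgData.IsHom.symm f hf, fun a ha => ?_⟩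
    rw [LinearEquiv.symm_apply_eq, hA a ha]
  trans := by
    rintro S T U ⟨f, hf, hA⟩ ⟨g, hg, hA'⟩
    refine ⟨f.trans g, hg.comp hf, fun a ha => ?_⟩
    rw [LinearEquiv.trans_apply, hA a ha, hA' a ha]

/-- The equivalence relation on extending structures. -/
def extSetoid (SA : InfBialgebra k lam A) (hAV : IsCompl A V) : Setoid (ExtStructure SA hAV) :=
  ⟨ExtEquiv SA hAV, extEquiv_equivalence SA hAV⟩

/-- The set `BExtd(E, A)`. -/
abbrev BExtd (SA : InfBialgebra k lam A) (hAV : IsCompl A V) := Quotient (extSetoid SA hAV)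

end Extending

end WeightedInf

/-!
Write the elements of `E` as pairs in `A ⊕ V`, so that a multiplication has eight components and a
comultiplication has eight components. If the projection onto `A` is a homomorphism, the
components of the multiplication with values in `A` and the components of the comultiplication
with values in `A ⊗ A` are those of `A`, extended by zero; what remains is exactly a datum of
type (I). If the inclusion of `A` is a homomorphism, the components that start in `A ⊗ A` or in
`A` are those of `A`, and what remains is exactly a datum of type (II)
(`DatumI.unified_ofProd`, `DatumII.unified_ofProd`; conversely `DatumI.isHom_fst`,
`DatumII.isHom_inl`).

It remains to see that the conditions that define `IB⁽¹⁾` and `IB⁽²⁾` are the weighted Leibniz rule.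
By bilinearity the rule can be tested on arguments in `A` or `V`, and for each of the four kinds of
pairs it splits into four components in `(A ⊕ V) ⊗ (A ⊕ V)`. One of the sixteen equations is the
Leibniz rule of `A`, three are trivial, and twelve are the conditions
(`compatAt_unified`, `isBialgebraic_iff`).

Hence every extending structure is the unified product of a datum (`extStructure_surjective`), and
since an isomorphism that fixes `A` has the form `(a, x) ↦ (a + r(x), s(x))`, two data are
equivalent if and only if their unified products are (`dataEquiv_iff_extEquiv`). This gives the
surjectivity of `Υ`, its well-definedness and its injectivity. A structure for which both the
inclusion and the projection are homomorphisms comes from one datum of each type; these two are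
equivalent through the identity.
-/

open scoped TensorProduct

namespace WeightedInf

variable {k : Type*} [Field k]

/-! ### Components in a direct sum -/

section Components

variable {A V : Type*} [AddCommGroup A] [Module k A] [AddCommGroup V] [Module k V]

/-- An element of `(A ⊕ V) ⊗ (A ⊕ V)` is the sum of its four components. -/
theorem tensor_prod_decomp (w : (A × V) ⊗[k] (A × V)) : w =
    TensorProduct.map (LinearMap.inl k A V) (LinearMap.inl k A V)
        (TensorProduct.map (LinearMap.fst k A V) (LinearMap.fst k A V) w)
      + TensorProduct.map (LinearMap.inl k A V) (LinearMap.inr k A V)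
        (TensorProduct.map (LinearMap.fst k A V) (LinearMap.snd k A V) w)
      + TensorProduct.map (LinearMap.inr k A V) (LinearMap.inl k A V)
        (TensorProduct.map (LinearMap.snd k A V) (LinearMap.fst k A V) w)
      + TensorProduct.map (LinearMap.inr k A V) (LinearMap.inr k A V)
        (TensorProduct.map (LinearMap.snd k A V) (LinearMap.snd k A V) w) := by
  have hid : (LinearMap.id : (A × V) →ₗ[k] A × V) =
      LinearMap.inl k A V ∘ₗ LinearMap.fst k A V + LinearMap.inr k A V ∘ₗ LinearMap.snd k A V := by
    ext <;> simp
  conv_lhs => rw [← LinearMap.id_apply (R := k) w, ← TensorProduct.map_id, hid]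
  simp only [TensorProduct.map_add_left, TensorProduct.map_add_right, LinearMap.add_apply,
    TensorProduct.map_map]
  abel

theorem tensor_prod_ext_iff {t u : (A × V) ⊗[k] (A × V)} : t = u ↔
    TensorProduct.map (LinearMap.fst k A V) (LinearMap.fst k A V) t =
      TensorProduct.map (LinearMap.fst k A V) (LinearMap.fst k A V) u ∧
    TensorProduct.map (LinearMap.fst k A V) (LinearMap.snd k A V) t =
      TensorProduct.map (LinearMap.fst k A V) (LinearMap.snd k A V) u ∧
    TensorProduct.map (LinearMap.snd k A V) (LinearMap.fst k A V) t =
      TensorProduct.map (LinearMap.snd k A V) (LinearMap.fst k A V) u ∧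
    TensorProduct.map (LinearMap.snd k A V) (LinearMap.snd k A V) t =
      TensorProduct.map (LinearMap.snd k A V) (LinearMap.snd k A V) u :=
  ⟨fun h => by simp [h], fun ⟨hAA, hAV, hVA, hVV⟩ => by
    rw [tensor_prod_decomp t, tensor_prod_decomp u, hAA, hAV, hVA, hVV]⟩

/-- The weighted Leibniz rule `Δ(p q) = p q₁ ⊗ q₂ + p₁ ⊗ p₂ q + lam (p ⊗ q)` for the single pair
`(p, q)`. -/
def BialgData.CompatAt {M : Type*} [AddCommGroup M] [Module k M] (S : BialgData k M) (lam : k)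
    (p q : M) : Prop :=
  S.comul (S.mul p q) =
    (S.mul p).rTensor M (S.comul q) + (S.mul.flip q).lTensor M (S.comul p) + lam • (p ⊗ₜ[k] q)

theorem BialgData.CompatAt.add_left {M : Type*} [AddCommGroup M] [Module k M] {S : BialgData k M}
    {lam : k} {p p' q : M} (h : S.CompatAt lam p q) (h' : S.CompatAt lam p' q) :
    S.CompatAt lam (p + p') q := by
  unfold BialgData.CompatAt at *
  simp only [map_add, LinearMap.add_apply, h, h', LinearMap.rTensor_add, TensorProduct.add_tmul,
    smul_add]
  abel

theorem BialgData.CompatAt.add_right {M : Type*} [AddCommGroup M] [Module k M] {S : BialgData k M}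
    {lam : k} {p q q' : M} (h : S.CompatAt lam p q) (h' : S.CompatAt lam p q') :
    S.CompatAt lam p (q + q') := by
  unfold BialgData.CompatAt at *
  simp only [map_add, LinearMap.add_apply, h, h', LinearMap.lTensor_add, TensorProduct.tmul_add,
    smul_add]
  abel

/-- By bilinearity, the weighted Leibniz rule on `A ⊕ V` need only be checked on pairs of
arguments each of which lies in one of the summands. -/
theorem BialgData.compatAt_prod (S : BialgData k (A × V)) (lam : k)
    (haa : ∀ a b : A, S.CompatAt lam (a, 0) (b, 0))
    (hax : ∀ (a : A) (y : V), S.CompatAt lam (a, 0) (0, y))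
    (hxa : ∀ (x : V) (b : A), S.CompatAt lam (0, x) (b, 0))
    (hxx : ∀ x y : V, S.CompatAt lam (0, x) (0, y)) (p q : A × V) : S.CompatAt lam p q := by
  obtain ⟨a, x⟩ := p
  obtain ⟨b, y⟩ := q
  have hp : ((a, x) : A × V) = (a, 0) + (0, x) := by simp
  have hq : ((b, y) : A × V) = (b, 0) + (0, y) := by simp
  rw [hp, hq]
  exact ((haa a b).add_right (hax a y)).add_left ((hxa x b).add_right (hxx x y))

theorem BialgData.mul_prod (S : BialgData k (A × V)) (p q : A × V) :
    S.mul p q = S.mul (p.1, 0) (q.1, 0) + S.mul (p.1, 0) (0, q.2) + S.mul (0, p.2) (q.1, 0)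
      + S.mul (0, p.2) (0, q.2) := by
  have hp : p = (p.1, 0) + (0, p.2) := by simp
  have hq : q = (q.1, 0) + (0, q.2) := by simp
  conv_lhs => rw [hp, hq]
  simp only [map_add, LinearMap.add_apply]
  abel

theorem BialgData.comul_prod (S : BialgData k (A × V)) (p : A × V) :
    S.comul p = S.comul (p.1, 0) + S.comul (0, p.2) := by
  rw [← map_add]; simp

/-! ### Unified products of type (I) -/

namespace DatumI

variable (D : DatumI k A V) (SA : BialgData k A)

theorem unified_mul (p q : A × V) : (D.unified SA).mul p q =
    (SA.mul p.1 q.1,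
      D.mulV p.2 q.2 + D.actR p.2 q.1 + D.actL p.1 q.2 + D.theta p.1 q.1) := rfl

theorem unified_comul (p : A × V) : (D.unified SA).comul p =
    TensorProduct.map (LinearMap.inl k A V) (LinearMap.inl k A V) (SA.comul p.1)
      + TensorProduct.map (LinearMap.inr k A V) (LinearMap.inl k A V) (D.phi p.1)
      + TensorProduct.map (LinearMap.inl k A V) (LinearMap.inr k A V) (D.psi p.1)
      + TensorProduct.map (LinearMap.inr k A V) (LinearMap.inr k A V) (D.P p.1)
      + TensorProduct.map (LinearMap.inr k A V) (LinearMap.inr k A V) (D.comulV p.2)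
      + TensorProduct.map (LinearMap.inl k A V) (LinearMap.inr k A V) (D.rho p.2)
      + TensorProduct.map (LinearMap.inr k A V) (LinearMap.inl k A V) (D.gamma p.2) := by
  simp [unified, add_assoc]

/-- The left and right multiplications of the unified product, as block matrices. -/
theorem unified_mul_components (p : A × V) :
    LinearMap.fst k A V ∘ₗ (D.unified SA).mul p ∘ₗ LinearMap.inl k A V =
      SA.mul p.1 ∧
    LinearMap.fst k A V ∘ₗ (D.unified SA).mul p ∘ₗ LinearMap.inr k A V =
      0 ∧
    LinearMap.snd k A V ∘ₗ (D.unified SA).mul p ∘ₗ LinearMap.inl k A V =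
      D.actR p.2 + D.theta p.1 ∧
    LinearMap.snd k A V ∘ₗ (D.unified SA).mul p ∘ₗ LinearMap.inr k A V =
      D.mulV p.2 + D.actL p.1 ∧
    LinearMap.fst k A V ∘ₗ (D.unified SA).mul.flip p ∘ₗ LinearMap.inl k A V =
      SA.mul.flip p.1 ∧
    LinearMap.fst k A V ∘ₗ (D.unified SA).mul.flip p ∘ₗ LinearMap.inr k A V =
      0 ∧
    LinearMap.snd k A V ∘ₗ (D.unified SA).mul.flip p ∘ₗ LinearMap.inl k A V =
      D.actL.flip p.2 + D.theta.flip p.1 ∧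
    LinearMap.snd k A V ∘ₗ (D.unified SA).mul.flip p ∘ₗ LinearMap.inr k A V =
      D.mulV.flip p.2 + D.actR.flip p.1 := by
  refine ⟨?_, ?_, ?_, ?_, ?_, ?_, ?_, ?_⟩ <;> ext <;> simp [unified_mul]

/-- The weighted Leibniz rule of the unified product, sorted by the summands in which the two
arguments lie and by the components in `(A ⊕ V) ⊗ (A ⊕ V)`; a missing component is `0 = 0`. -/
theorem compatAt_unified (lam : k) :
    (∀ (a b : A),
      (D.unified SA).CompatAt lam (a, 0) (b, 0) ↔
        SA.CompatAt lam a b ∧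
        (D.psi (SA.mul a b) + D.rho (D.theta a b) =
          (SA.mul a).rTensor V (D.psi b) + (D.actR.flip b).lTensor A (D.psi a)
            + (D.theta.flip b).lTensor A (SA.comul a)) ∧
        (D.phi (SA.mul a b) + D.gamma (D.theta a b) =
          (SA.mul.flip b).lTensor V (D.phi a) + (D.actL a).rTensor A (D.phi b)
            + (D.theta a).rTensor A (SA.comul b)) ∧
        (D.comulV (D.theta a b) + D.P (SA.mul a b) =
          (D.theta.flip b).lTensor V (D.phi a) + (D.actR.flip b).lTensor V (D.P a)
            + (D.theta a).rTensor V (D.psi b) + (D.actL a).rTensor V (D.P b))) ∧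
    (∀ (a : A) (y : V),
      (D.unified SA).CompatAt lam (a, 0) (0, y) ↔
        (D.rho (D.actL a y) =
          (D.mulV.flip y).lTensor A (D.psi a) + (D.actL.flip y).lTensor A (SA.comul a)
            + (SA.mul a).rTensor V (D.rho y) + lam • (a ⊗ₜ[k] y)) ∧
        (D.gamma (D.actL a y) = (D.actL a).rTensor A (D.gamma y)) ∧
        (D.comulV (D.actL a y) =
          (D.actL.flip y).lTensor V (D.phi a) + (D.actL a).rTensor V (D.comulV y)
            + (D.mulV.flip y).lTensor V (D.P a) + (D.theta a).rTensor V (D.rho y))) ∧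
    (∀ (x : V) (b : A),
      (D.unified SA).CompatAt lam (0, x) (b, 0) ↔
        (D.rho (D.actR x b) = (D.actR.flip b).lTensor A (D.rho x)) ∧
        (D.gamma (D.actR x b) =
          (D.mulV x).rTensor A (D.phi b) + (SA.mul.flip b).lTensor V (D.gamma x)
            + (D.actR x).rTensor A (SA.comul b) + lam • (x ⊗ₜ[k] b)) ∧
        (D.comulV (D.actR x b) =
          (D.actR.flip b).lTensor V (D.comulV x) + (D.actR x).rTensor V (D.psi b)
            + (D.theta.flip b).lTensor V (D.gamma x) + (D.mulV x).rTensor V (D.P b))) ∧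
    (∀ (x y : V),
      (D.unified SA).CompatAt lam (0, x) (0, y) ↔
        (D.rho (D.mulV x y) = (D.mulV.flip y).lTensor A (D.rho x)) ∧
        (D.gamma (D.mulV x y) = (D.mulV x).rTensor A (D.gamma y)) ∧
        (D.comulV (D.mulV x y) =
          (D.mulV.flip y).lTensor V (D.comulV x) + (D.mulV x).rTensor V (D.comulV y)
            + (D.actL.flip y).lTensor V (D.gamma x) + (D.actR x).rTensor V (D.rho y)
            + lam • (x ⊗ₜ[k] y))) := by
  -- each component of the rule agrees with its condition up to the order of the summands
  refine ⟨fun a b => ?_, fun a y => ?_, fun x b => ?_, fun x y => ?_⟩ <;>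
  rw [BialgData.CompatAt, tensor_prod_ext_iff] <;>
  simp only [BialgData.CompatAt, unified_mul, unified_comul, unified_mul_components, map_add,
    map_smul, LinearMap.rTensor, LinearMap.lTensor, TensorProduct.map_map, LinearMap.id_comp,
    LinearMap.fst_comp_inl, LinearMap.fst_comp_inr, LinearMap.snd_comp_inl,
    LinearMap.snd_comp_inr, map_zero, LinearMap.zero_apply, TensorProduct.map_zero_left,
    TensorProduct.map_zero_right, add_zero, zero_add, TensorProduct.map_id, LinearMap.id_apply,
    TensorProduct.map_tmul, LinearMap.fst_apply, LinearMap.snd_apply, TensorProduct.zero_tmul,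
    TensorProduct.tmul_zero, smul_zero, true_and] <;>
  simp only [add_comm, add_left_comm]

variable {SA} in
/-- Over an infinitesimal bialgebra `A`, the twelve conditions on a datum of type (I) are the
nontrivial components of the weighted Leibniz rule of the unified product. -/
theorem isBialgebraic_iff {lam : k} (hA : ∀ a b : A, SA.CompatAt lam a b) :
    D.IsBialgebraic lam SA ↔ IsAssociative (D.unified SA).mul ∧
      IsCoassociative (D.unified SA).comul ∧ ∀ p q, (D.unified SA).CompatAt lam p q := by
  obtain ⟨haa, hax, hxa, hxx⟩ := D.compatAt_unified SA lam
  constructor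
  · intro h
    refine ⟨h.assoc, h.coassoc, BialgData.compatAt_prod _ lam ?_ ?_ ?_ ?_⟩
    · exact fun a b => (haa a b).2
        ⟨hA a b, h.aa_AV a b, h.aa_VA a b, h.aa_VV a b⟩
    · exact fun a y => (hax a y).2 ⟨h.ax_AV a y, h.ax_VA a y, h.ax_VV a y⟩
    · exact fun x b => (hxa x b).2 ⟨h.xa_AV x b, h.xa_VA x b, h.xa_VV x b⟩
    · exact fun x y => (hxx x y).2 ⟨h.xx_AV x y, h.xx_VA x y, h.xx_VV x y⟩
  · rintro ⟨hm, hc, h⟩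
    replace haa (a b : A) := (haa a b).1 (h (a, 0) (b, 0))
    replace hax (a : A) (y : V) := (hax a y).1 (h (a, 0) (0, y))
    replace hxa (x : V) (b : A) := (hxa x b).1 (h (0, x) (b, 0))
    replace hxx (x y : V) := (hxx x y).1 (h (0, x) (0, y))
    exact
      { assoc := hm
        coassoc := hc
        aa_AV := fun a b => (haa a b).2.1
        aa_VA := fun a b => (haa a b).2.2.1
        aa_VV := fun a b => (haa a b).2.2.2
        ax_AV := fun a y => (hax a y).1
        ax_VA := fun a y => (hax a y).2.1
        ax_VV := fun a y => (hax a y).2.2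
        xa_AV := fun x b => (hxa x b).1
        xa_VA := fun x b => (hxa x b).2.1
        xa_VV := fun x b => (hxa x b).2.2
        xx_AV := fun x y => (hxx x y).1
        xx_VA := fun x y => (hxx x y).2.1
        xx_VV := fun x y => (hxx x y).2.2 }

/-- The projection of a unified product of type (I) onto `A` is a homomorphism. -/
theorem isHom_fst : (D.unified SA).IsHom SA (LinearMap.fst k A V) where
  map_mul p q := rfl
  map_comul p := by
    simp only [unified_comul, map_add, TensorProduct.map_map, LinearMap.fst_comp_inl,
      LinearMap.fst_comp_inr, TensorProduct.map_zero_left, TensorProduct.map_zero_right,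
      LinearMap.zero_apply, add_zero, TensorProduct.map_id, LinearMap.id_apply,
      LinearMap.fst_apply]

/-- The datum of type (I) read off from the components of a structure on `A ⊕ V`: those components
that do not appear here are fixed when the projection onto `A` is a homomorphism. -/
def ofProd (S : BialgData k (A × V)) : DatumI k A V where
  actL :=
    (S.mul.compl₁₂ (LinearMap.inl k A V) (LinearMap.inr k A V)).compr₂ (LinearMap.snd k A V)
  actR :=
    (S.mul.compl₁₂ (LinearMap.inr k A V) (LinearMap.inl k A V)).compr₂ (LinearMap.snd k A V)
  theta :=
    (S.mul.compl₁₂ (LinearMap.inl k A V) (LinearMap.inl k A V)).compr₂ (LinearMap.snd k A V)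
  mulV :=
    (S.mul.compl₁₂ (LinearMap.inr k A V) (LinearMap.inr k A V)).compr₂ (LinearMap.snd k A V)
  phi :=
    TensorProduct.map (LinearMap.snd k A V) (LinearMap.fst k A V) ∘ₗ
      S.comul ∘ₗ LinearMap.inl k A V
  psi :=
    TensorProduct.map (LinearMap.fst k A V) (LinearMap.snd k A V) ∘ₗ
      S.comul ∘ₗ LinearMap.inl k A V
  P :=
    TensorProduct.map (LinearMap.snd k A V) (LinearMap.snd k A V) ∘ₗ
      S.comul ∘ₗ LinearMap.inl k A V
  comulV :=
    TensorProduct.map (LinearMap.snd k A V) (LinearMap.snd k A V) ∘ₗ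
      S.comul ∘ₗ LinearMap.inr k A V
  rho :=
    TensorProduct.map (LinearMap.fst k A V) (LinearMap.snd k A V) ∘ₗ
      S.comul ∘ₗ LinearMap.inr k A V
  gamma :=
    TensorProduct.map (LinearMap.snd k A V) (LinearMap.fst k A V) ∘ₗ
      S.comul ∘ₗ LinearMap.inr k A V

theorem unified_ofProd {S : BialgData k (A × V)} {SA : BialgData k A}
    (h : S.IsHom SA (LinearMap.fst k A V)) : (ofProd S).unified SA = S := by
  apply BialgData.ext
  · refine LinearMap.ext₂ fun p q => ?_
    refine Prod.ext ?_ ?_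
    · exact (h.map_mul p q).symm
    · rw [unified_mul, S.mul_prod p q]
      simp only [ofProd, LinearMap.compr₂_apply, LinearMap.compl₁₂_apply, LinearMap.inl_apply,
        LinearMap.inr_apply, LinearMap.snd_apply, Prod.snd_add]
      abel
  · refine LinearMap.ext fun p => ?_
    have hc (p : A × V) : TensorProduct.map (LinearMap.fst k A V) (LinearMap.fst k A V)
        (S.comul p) = SA.comul p.1 := (h.map_comul p).symm
    rw [unified_comul, S.comul_prod p, tensor_prod_decomp (S.comul (p.1, 0)),
      tensor_prod_decomp (S.comul (0, p.2)), hc, hc, map_zero, map_zero, zero_add]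
    simp only [ofProd, LinearMap.comp_apply, LinearMap.inl_apply, LinearMap.inr_apply]
    abel

end DatumI

/-! ### Unified products of type (II) -/

namespace DatumII

variable (D : DatumII k A V) (SA : BialgData k A)

theorem unified_mul (p q : A × V) : (D.unified SA).mul p q =
    (SA.mul p.1 q.1 + D.harpL p.2 q.1 + D.harpR p.1 q.2 + D.sigma p.2 q.2,
      D.mulV p.2 q.2 + D.actR p.2 q.1 + D.actL p.1 q.2) := rfl

theorem unified_comul (p : A × V) : (D.unified SA).comul p =
    TensorProduct.map (LinearMap.inl k A V) (LinearMap.inl k A V) (SA.comul p.1)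
      + TensorProduct.map (LinearMap.inr k A V) (LinearMap.inr k A V) (D.comulV p.2)
      + TensorProduct.map (LinearMap.inl k A V) (LinearMap.inr k A V) (D.rho p.2)
      + TensorProduct.map (LinearMap.inr k A V) (LinearMap.inl k A V) (D.gamma p.2)
      + TensorProduct.map (LinearMap.inl k A V) (LinearMap.inl k A V) (D.Q p.2) := by
  simp [unified, add_assoc]

/-- The left and right multiplications of the unified product, as block matrices. -/
theorem unified_mul_components (p : A × V) :
    LinearMap.fst k A V ∘ₗ (D.unified SA).mul p ∘ₗ LinearMap.inl k A V =
      SA.mul p.1 + D.harpL p.2 ∧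
    LinearMap.fst k A V ∘ₗ (D.unified SA).mul p ∘ₗ LinearMap.inr k A V =
      D.harpR p.1 + D.sigma p.2 ∧
    LinearMap.snd k A V ∘ₗ (D.unified SA).mul p ∘ₗ LinearMap.inl k A V =
      D.actR p.2 ∧
    LinearMap.snd k A V ∘ₗ (D.unified SA).mul p ∘ₗ LinearMap.inr k A V =
      D.mulV p.2 + D.actL p.1 ∧
    LinearMap.fst k A V ∘ₗ (D.unified SA).mul.flip p ∘ₗ LinearMap.inl k A V =
      SA.mul.flip p.1 + D.harpR.flip p.2 ∧
    LinearMap.fst k A V ∘ₗ (D.unified SA).mul.flip p ∘ₗ LinearMap.inr k A V =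
      D.harpL.flip p.1 + D.sigma.flip p.2 ∧
    LinearMap.snd k A V ∘ₗ (D.unified SA).mul.flip p ∘ₗ LinearMap.inl k A V =
      D.actL.flip p.2 ∧
    LinearMap.snd k A V ∘ₗ (D.unified SA).mul.flip p ∘ₗ LinearMap.inr k A V =
      D.mulV.flip p.2 + D.actR.flip p.1 := by
  refine ⟨?_, ?_, ?_, ?_, ?_, ?_, ?_, ?_⟩ <;> ext <;> simp [unified_mul]

/-- The weighted Leibniz rule of the unified product, sorted by the summands in which the two
arguments lie and by the components in `(A ⊕ V) ⊗ (A ⊕ V)`; a missing component is `0 = 0`. -/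
theorem compatAt_unified (lam : k) :
    (∀ (a b : A),
      (D.unified SA).CompatAt lam (a, 0) (b, 0) ↔
        SA.CompatAt lam a b) ∧
    (∀ (a : A) (y : V),
      (D.unified SA).CompatAt lam (a, 0) (0, y) ↔
        (SA.comul (D.harpR a y) + D.Q (D.actL a y) =
          (D.harpR.flip y).lTensor A (SA.comul a) + (D.harpR a).rTensor A (D.gamma y)
            + (SA.mul a).rTensor A (D.Q y)) ∧
        (D.rho (D.actL a y) =
          (D.harpR a).rTensor V (D.comulV y) + (D.actL.flip y).lTensor A (SA.comul a)
            + (SA.mul a).rTensor V (D.rho y) + lam • (a ⊗ₜ[k] y)) ∧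
        (D.gamma (D.actL a y) = (D.actL a).rTensor A (D.gamma y)) ∧
        (D.comulV (D.actL a y) = (D.actL a).rTensor V (D.comulV y))) ∧
    (∀ (x : V) (b : A),
      (D.unified SA).CompatAt lam (0, x) (b, 0) ↔
        (SA.comul (D.harpL x b) + D.Q (D.actR x b) =
          (D.harpL.flip b).lTensor A (D.rho x) + (D.harpL x).rTensor A (SA.comul b)
            + (SA.mul.flip b).lTensor A (D.Q x)) ∧
        (D.rho (D.actR x b) = (D.actR.flip b).lTensor A (D.rho x)) ∧
        (D.gamma (D.actR x b) =
          (D.harpL.flip b).lTensor V (D.comulV x) + (SA.mul.flip b).lTensor V (D.gamma x)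
            + (D.actR x).rTensor A (SA.comul b) + lam • (x ⊗ₜ[k] b)) ∧
        (D.comulV (D.actR x b) = (D.actR.flip b).lTensor V (D.comulV x))) ∧
    (∀ (x y : V),
      (D.unified SA).CompatAt lam (0, x) (0, y) ↔
        (SA.comul (D.sigma x y) + D.Q (D.mulV x y) =
          (D.sigma.flip y).lTensor A (D.rho x) + (D.harpR.flip y).lTensor A (D.Q x)
            + (D.sigma x).rTensor A (D.gamma y) + (D.harpL x).rTensor A (D.Q y)) ∧
        (D.rho (D.mulV x y) =
          (D.mulV.flip y).lTensor A (D.rho x) + (D.harpL x).rTensor V (D.rho y)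
            + (D.actL.flip y).lTensor A (D.Q x) + (D.sigma x).rTensor V (D.comulV y)) ∧
        (D.gamma (D.mulV x y) =
          (D.harpR.flip y).lTensor V (D.gamma x) + (D.mulV x).rTensor A (D.gamma y)
            + (D.sigma.flip y).lTensor V (D.comulV x) + (D.actR x).rTensor A (D.Q y)) ∧
        (D.comulV (D.mulV x y) =
          (D.mulV.flip y).lTensor V (D.comulV x) + (D.mulV x).rTensor V (D.comulV y)
            + (D.actL.flip y).lTensor V (D.gamma x) + (D.actR x).rTensor V (D.rho y)
            + lam • (x ⊗ₜ[k] y))) := by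
  -- each component of the rule agrees with its condition up to the order of the summands
  refine ⟨fun a b => ?_, fun a y => ?_, fun x b => ?_, fun x y => ?_⟩ <;>
  rw [BialgData.CompatAt, tensor_prod_ext_iff] <;>
  simp only [BialgData.CompatAt, unified_mul, unified_comul, unified_mul_components, map_add,
    map_smul, LinearMap.rTensor, LinearMap.lTensor, TensorProduct.map_map, LinearMap.id_comp,
    LinearMap.fst_comp_inl, LinearMap.fst_comp_inr, LinearMap.snd_comp_inl,
    LinearMap.snd_comp_inr, map_zero, LinearMap.zero_apply, TensorProduct.map_zero_left,
    TensorProduct.map_zero_right, add_zero, zero_add, TensorProduct.map_id, LinearMap.id_apply,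
    TensorProduct.map_tmul, LinearMap.fst_apply, LinearMap.snd_apply, TensorProduct.zero_tmul,
    TensorProduct.tmul_zero, smul_zero, and_true] <;>
  simp only [add_comm, add_left_comm, add_assoc]

variable {SA} in
/-- Over an infinitesimal bialgebra `A`, the twelve conditions on a datum of type (II) are the
nontrivial components of the weighted Leibniz rule of the unified product. -/
theorem isBialgebraic_iff {lam : k} (hA : ∀ a b : A, SA.CompatAt lam a b) :
    D.IsBialgebraic lam SA ↔ IsAssociative (D.unified SA).mul ∧
      IsCoassociative (D.unified SA).comul ∧ ∀ p q, (D.unified SA).CompatAt lam p q := by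
  obtain ⟨haa, hax, hxa, hxx⟩ := D.compatAt_unified SA lam
  constructor
  · intro h
    refine ⟨h.assoc, h.coassoc, BialgData.compatAt_prod _ lam ?_ ?_ ?_ ?_⟩
    · exact fun a b => (haa a b).2 (hA a b)
    · exact fun a y => (hax a y).2 ⟨h.ax_AA a y, h.ax_AV a y, h.ax_VA a y, h.ax_VV a y⟩
    · exact fun x b => (hxa x b).2 ⟨h.xa_AA x b, h.xa_AV x b, h.xa_VA x b, h.xa_VV x b⟩
    · exact fun x y => (hxx x y).2 ⟨h.xx_AA x y, h.xx_AV x y, h.xx_VA x y, h.xx_VV x y⟩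
  · rintro ⟨hm, hc, h⟩
    replace haa (a b : A) := (haa a b).1 (h (a, 0) (b, 0))
    replace hax (a : A) (y : V) := (hax a y).1 (h (a, 0) (0, y))
    replace hxa (x : V) (b : A) := (hxa x b).1 (h (0, x) (b, 0))
    replace hxx (x y : V) := (hxx x y).1 (h (0, x) (0, y))
    exact
      { assoc := hm
        coassoc := hc
        ax_AA := fun a y => (hax a y).1
        ax_AV := fun a y => (hax a y).2.1
        ax_VA := fun a y => (hax a y).2.2.1
        ax_VV := fun a y => (hax a y).2.2.2
        xa_AA := fun x b => (hxa x b).1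
        xa_AV := fun x b => (hxa x b).2.1
        xa_VA := fun x b => (hxa x b).2.2.1
        xa_VV := fun x b => (hxa x b).2.2.2
        xx_AA := fun x y => (hxx x y).1
        xx_AV := fun x y => (hxx x y).2.1
        xx_VA := fun x y => (hxx x y).2.2.1
        xx_VV := fun x y => (hxx x y).2.2.2 }

/-- The inclusion of `A` into a unified product of type (II) is a homomorphism. -/
theorem isHom_inl : SA.IsHom (D.unified SA) (LinearMap.inl k A V) where
  map_mul a b := by simp [unified_mul]
  map_comul a := by simp [unified_comul]

/-- The datum of type (II) read off from the components of a structure on `A ⊕ V`: those components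
that do not appear here are fixed when the inclusion of `A` is a homomorphism. -/
def ofProd (S : BialgData k (A × V)) : DatumII k A V where
  harpL :=
    (S.mul.compl₁₂ (LinearMap.inr k A V) (LinearMap.inl k A V)).compr₂ (LinearMap.fst k A V)
  harpR :=
    (S.mul.compl₁₂ (LinearMap.inl k A V) (LinearMap.inr k A V)).compr₂ (LinearMap.fst k A V)
  actL :=
    (S.mul.compl₁₂ (LinearMap.inl k A V) (LinearMap.inr k A V)).compr₂ (LinearMap.snd k A V)
  actR :=
    (S.mul.compl₁₂ (LinearMap.inr k A V) (LinearMap.inl k A V)).compr₂ (LinearMap.snd k A V)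
  sigma :=
    (S.mul.compl₁₂ (LinearMap.inr k A V) (LinearMap.inr k A V)).compr₂ (LinearMap.fst k A V)
  mulV :=
    (S.mul.compl₁₂ (LinearMap.inr k A V) (LinearMap.inr k A V)).compr₂ (LinearMap.snd k A V)
  comulV :=
    TensorProduct.map (LinearMap.snd k A V) (LinearMap.snd k A V) ∘ₗ
      S.comul ∘ₗ LinearMap.inr k A V
  rho :=
    TensorProduct.map (LinearMap.fst k A V) (LinearMap.snd k A V) ∘ₗ
      S.comul ∘ₗ LinearMap.inr k A V
  gamma :=
    TensorProduct.map (LinearMap.snd k A V) (LinearMap.fst k A V) ∘ₗ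
      S.comul ∘ₗ LinearMap.inr k A V
  Q :=
    TensorProduct.map (LinearMap.fst k A V) (LinearMap.fst k A V) ∘ₗ
      S.comul ∘ₗ LinearMap.inr k A V

theorem unified_ofProd {S : BialgData k (A × V)} {SA : BialgData k A}
    (h : SA.IsHom S (LinearMap.inl k A V)) : (ofProd S).unified SA = S := by
  have haa (a b : A) : S.mul (a, 0) (b, 0) = (SA.mul a b, 0) := (h.map_mul a b).symm
  have hc (a : A) : S.comul (a, 0) = _ := h.map_comul a
  apply BialgData.ext
  · refine LinearMap.ext₂ fun p q => ?_
    rw [unified_mul, S.mul_prod p q, haa]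
    refine Prod.ext ?_ ?_
    · simp only [ofProd, LinearMap.compr₂_apply, LinearMap.compl₁₂_apply, LinearMap.inl_apply,
        LinearMap.inr_apply, LinearMap.fst_apply, Prod.fst_add]
      abel
    · simp only [ofProd, LinearMap.compr₂_apply, LinearMap.compl₁₂_apply, LinearMap.inl_apply,
        LinearMap.inr_apply, LinearMap.snd_apply, Prod.snd_add, zero_add]
      abel
  · refine LinearMap.ext fun p => ?_
    rw [unified_comul, S.comul_prod p, hc, tensor_prod_decomp (S.comul (0, p.2))]
    simp only [ofProd, LinearMap.comp_apply, LinearMap.inr_apply]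
    abel

end DatumII

end Components

/-! ### Transport along linear isomorphisms -/

section Transport

variable {M N : Type*} [AddCommGroup M] [Module k M] [AddCommGroup N] [Module k N]

namespace BialgData

theorem isHom_transport (S : BialgData k M) (e : M ≃ₗ[k] N) :
    S.IsHom (S.transport e) e.toLinearMap where
  map_mul a b := by simp [transport]
  map_comul a := by simp [transport]

theorem transport_symm_transport (S : BialgData k N) (e : M ≃ₗ[k] N) :
    (S.transport e.symm).transport e = S := by
  apply BialgData.ext
  · ext a b
    simp [transport]
  · ext a
    simp [transport, TensorProduct.map_map]

variable {S : BialgData k M} {T : BialgData k N}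

namespace IsHom

theorem isAssociative (e : M ≃ₗ[k] N) (h : S.IsHom T e.toLinearMap) (hS : IsAssociative S.mul) :
    IsAssociative T.mul := by
  intro a b c
  have hm (x y : M) : T.mul (e x) (e y) = e (S.mul x y) := (h.map_mul x y).symm
  obtain ⟨a, rfl⟩ := e.surjective a
  obtain ⟨b, rfl⟩ := e.surjective b
  obtain ⟨c, rfl⟩ := e.surjective c
  simp only [hm, hS a b c]

theorem isCoassociative (e : M ≃ₗ[k] N) (h : S.IsHom T e.toLinearMap)
    (hS : IsCoassociative S.comul) : IsCoassociative T.comul := by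
  intro a
  have hc : T.comul ∘ₗ e.toLinearMap =
      TensorProduct.map e.toLinearMap e.toLinearMap ∘ₗ S.comul := LinearMap.ext h.map_comul
  obtain ⟨a, rfl⟩ := e.surjective a
  have ha : T.comul (e a) = _ := h.map_comul a
  have hr (t : M ⊗[k] M) : T.comul.rTensor N (TensorProduct.map e.toLinearMap e.toLinearMap t) =
      TensorProduct.map (TensorProduct.map e.toLinearMap e.toLinearMap) e.toLinearMap
        (S.comul.rTensor M t) := by
    simp only [LinearMap.rTensor, TensorProduct.map_map, hc, LinearMap.id_comp, LinearMap.comp_id]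
  have hl (t : M ⊗[k] M) : T.comul.lTensor N (TensorProduct.map e.toLinearMap e.toLinearMap t) =
      TensorProduct.map e.toLinearMap (TensorProduct.map e.toLinearMap e.toLinearMap)
        (S.comul.lTensor M t) := by
    simp only [LinearMap.lTensor, TensorProduct.map_map, hc, LinearMap.id_comp, LinearMap.comp_id]
  rw [ha, hr, hl, ← TensorProduct.map_map_assoc, hS a]

theorem compatAt (e : M ≃ₗ[k] N) (h : S.IsHom T e.toLinearMap) {lam : k}
    (hS : ∀ p q, S.CompatAt lam p q) (p q : N) : T.CompatAt lam p q := by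
  have hm (x y : M) : T.mul (e x) (e y) = e (S.mul x y) := (h.map_mul x y).symm
  have hc (x : M) : T.comul (e x) = _ := h.map_comul x
  obtain ⟨p, rfl⟩ := e.surjective p
  obtain ⟨q, rfl⟩ := e.surjective q
  have hp : T.mul (e p) ∘ₗ e.toLinearMap = e.toLinearMap ∘ₗ S.mul p :=
    LinearMap.ext (hm p)
  have hq : T.mul.flip (e q) ∘ₗ e.toLinearMap = e.toLinearMap ∘ₗ S.mul.flip q :=
    LinearMap.ext fun x => hm x q
  unfold CompatAt
  rw [hm, hc, hc, hc, hS p q]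
  simp only [LinearMap.rTensor, LinearMap.lTensor, TensorProduct.map_map, map_add, map_smul, hp, hq,
    LinearMap.id_comp, LinearMap.comp_id, TensorProduct.map_tmul, LinearEquiv.coe_coe]

end IsHom

end BialgData

end Transport

/-! ### Unified products as extending structures -/

section Extending

variable {E : Type*} [AddCommGroup E] [Module k E] {lam : k} {A V : Submodule k E}

theorem unified_laws (SA : InfBialgebra k lam A)
    (Ω : IBI lam SA.toBialgData V ⊕ IBII lam SA.toBialgData V) :
    IsAssociative (unified lam SA.toBialgData Ω).mul ∧
      IsCoassociative (unified lam SA.toBialgData Ω).comul ∧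
      ∀ p q, (unified lam SA.toBialgData Ω).CompatAt lam p q := by
  rcases Ω with D | D
  · exact (D.1.isBialgebraic_iff SA.compat).1 D.2
  · exact (D.1.isBialgebraic_iff SA.compat).1 D.2

/-- The unified product of an extending datum, as a structure on `E = A ⊕ V`. -/
noncomputable def extStructure (SA : InfBialgebra k lam A) (hAV : IsCompl A V)
    (Ω : IBI lam SA.toBialgData V ⊕ IBII lam SA.toBialgData V) : ExtStructure SA hAV :=
  ⟨{ toBialgData := (unified lam SA.toBialgData Ω).transport (A.prodEquivOfIsCompl V hAV)
     assoc := (BialgData.isHom_transport _ _).isAssociative _ (unified_laws SA Ω).1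
     coassoc := (BialgData.isHom_transport _ _).isCoassociative _ (unified_laws SA Ω).2.1
     compat := (BialgData.isHom_transport _ _).compatAt _ (unified_laws SA Ω).2.2 }, by
    have he := BialgData.isHom_transport (unified lam SA.toBialgData Ω)
      (A.prodEquivOfIsCompl V hAV)
    rcases Ω with D | D
    · refine Or.inr ?_
      have hfst : LinearMap.fst k A V ∘ₗ (A.prodEquivOfIsCompl V hAV).symm.toLinearMap =
          A.projectionOnto V hAV := by
        ext x; simp
      rw [← hfst]
      exact (D.1.isHom_fst SA.toBialgData).comp he.symm
    · refine Or.inl ?_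
      have hinl : (A.prodEquivOfIsCompl V hAV).toLinearMap ∘ₗ LinearMap.inl k A V = A.subtype := by
        ext x; simp
      rw [← hinl]
      exact he.comp (D.1.isHom_inl SA.toBialgData)⟩

/-- Isomorphisms of `E = A ⊕ V` that fix `A` pointwise are exactly the bijective maps
`(a, x) ↦ (a + r(x), s(x))`, so the two equivalence relations correspond. -/
theorem dataEquiv_iff_extEquiv (SA : InfBialgebra k lam A) (hAV : IsCompl A V)
    (Ω Ω' : IBI lam SA.toBialgData V ⊕ IBII lam SA.toBialgData V) :
    DataEquiv lam SA.toBialgData Ω Ω' ↔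
      ExtEquiv SA hAV (extStructure SA hAV Ω) (extStructure SA hAV Ω') := by
  set e := A.prodEquivOfIsCompl V hAV with he
  have hS := BialgData.isHom_transport (unified lam SA.toBialgData Ω) e
  have hT := BialgData.isHom_transport (unified lam SA.toBialgData Ω') e
  have heA (a : A) : e (a, 0) = a := by simp [he]
  constructor
  · rintro ⟨r, s, hb, hh⟩
    let g := LinearEquiv.ofBijective (phiRS r s) hb
    have hg : (unified lam SA.toBialgData Ω).IsHom (unified lam SA.toBialgData Ω')
        g.toLinearMap := hh
    refine ⟨(e.symm.trans g).trans e, hT.comp (hg.comp hS.symm), fun a ha => ?_⟩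
    have hea : e.symm a = (⟨a, ha⟩, 0) := by
      rw [LinearEquiv.symm_apply_eq, heA]
    simp [hea, g, phiRS_apply, heA]
  · rintro ⟨f, hf, hA⟩
    let g := (e.trans f).trans e.symm
    have hg (a : A) : g (a, 0) = (a, 0) := by
      simp [g, heA, hA a a.2, LinearEquiv.symm_apply_eq]
    have h : phiRS (LinearMap.fst k A V ∘ₗ g.toLinearMap ∘ₗ LinearMap.inr k A V)
        (LinearMap.snd k A V ∘ₗ g.toLinearMap ∘ₗ LinearMap.inr k A V) = g.toLinearMap := by
      apply LinearMap.prod_ext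
      · ext a <;> simp [phiRS_apply, hg]
      · ext a <;> simp [phiRS_apply]
    exact ⟨_, _, by rw [h]; exact g.bijective, by rw [h]; exact hT.symm.comp (hf.comp hS)⟩

/-- A structure on `E` for which the projection onto `A` is a homomorphism comes from a datum of
type (I), and one for which the inclusion of `A` is a homomorphism from a datum of type (II). -/
theorem extStructure_surjective (SA : InfBialgebra k lam A) (hAV : IsCompl A V) :
    Function.Surjective (extStructure SA hAV) := by
  rintro ⟨S, hS⟩
  let e := A.prodEquivOfIsCompl V hAV
  have hST := BialgData.isHom_transport S.toBialgData e.symm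
  have laws : IsAssociative (S.toBialgData.transport e.symm).mul ∧
      IsCoassociative (S.toBialgData.transport e.symm).comul ∧
      ∀ p q, (S.toBialgData.transport e.symm).CompatAt lam p q :=
    ⟨hST.isAssociative _ S.assoc, hST.isCoassociative _ S.coassoc, hST.compatAt _ S.compat⟩
  suffices h : ∃ Ω : IBI lam SA.toBialgData V ⊕ IBII lam SA.toBialgData V,
      unified lam SA.toBialgData Ω = S.toBialgData.transport e.symm by
    obtain ⟨Ω, hΩ⟩ := h
    refine ⟨Ω, Subtype.ext ?_⟩
    have key : (extStructure SA hAV Ω).1.toBialgData = S.toBialgData := by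
      change (unified lam SA.toBialgData Ω).transport e = _
      rw [hΩ, BialgData.transport_symm_transport]
    -- the remaining fields of an `InfBialgebra` are proofs
    generalize (extStructure SA hAV Ω).1 = T at key
    cases S; cases T; cases key; rfl
  rcases hS with hS | hS
  · have hinl : e.symm.toLinearMap ∘ₗ A.subtype = LinearMap.inl k A V := by
      ext x <;> simp [e]
    have hD := DatumII.unified_ofProd (hinl ▸ hST.comp hS)
    have laws' := (DatumII.isBialgebraic_iff (DatumII.ofProd _) SA.compat).2 (hD.symm ▸ laws)
    exact ⟨Sum.inr ⟨_, laws'⟩, hD⟩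
  · have hfst : A.projectionOnto V hAV ∘ₗ e.toLinearMap = LinearMap.fst k A V := by
      ext x <;> simp [e]
    have hD := DatumI.unified_ofProd (hfst ▸ hS.comp hST.symm)
    have laws' := (DatumI.isBialgebraic_iff (DatumI.ofProd _) SA.compat).2 (hD.symm ▸ laws)
    exact ⟨Sum.inl ⟨_, laws'⟩, hD⟩

end Extending

end WeightedInf

theorem mainTheorem1 {k : Type*} [Field k] [CharZero k] (lam : k)
    {E : Type*} [AddCommGroup E] [Module k E] (A V : Submodule k E) (hAV : IsCompl A V)
    (SA : WeightedInf.InfBialgebra k lam A) :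
    ∃ Υ : WeightedInf.HLB lam SA.toBialgData V → WeightedInf.BExtd SA hAV,
      (∀ Ω : WeightedInf.IBI lam SA.toBialgData V,
        ∃ S : WeightedInf.ExtStructure SA hAV,
          S.1.toBialgData =
            (Ω.1.unified SA.toBialgData).transport (A.prodEquivOfIsCompl V hAV) ∧
          Υ (Quotient.mk _ (Sum.inl Ω)) = Quotient.mk _ S) ∧
      (∀ Ω : WeightedInf.IBII lam SA.toBialgData V,
        ∃ S : WeightedInf.ExtStructure SA hAV,
          S.1.toBialgData =
            (Ω.1.unified SA.toBialgData).transport (A.prodEquivOfIsCompl V hAV) ∧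
          Υ (Quotient.mk _ (Sum.inr Ω)) = Quotient.mk _ S) ∧
      Function.Bijective Υ := by
  refine ⟨Quotient.map (WeightedInf.extStructure SA hAV)
      fun Ω Ω' h => (WeightedInf.dataEquiv_iff_extEquiv SA hAV Ω Ω').1 h,
    fun Ω => ⟨WeightedInf.extStructure SA hAV (Sum.inl Ω), rfl, rfl⟩,
    fun Ω => ⟨WeightedInf.extStructure SA hAV (Sum.inr Ω), rfl, rfl⟩, ?_, ?_⟩
  · rintro ⟨Ω⟩ ⟨Ω'⟩ h
    exact Quotient.sound ((WeightedInf.dataEquiv_iff_extEquiv SA hAV Ω Ω').2 (Quotient.exact h))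
  · rintro ⟨S⟩
    obtain ⟨Ω, rfl⟩ := WeightedInf.extStructure_surjective SA hAV S
    exact ⟨Quotient.mk _ Ω, rfl⟩
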